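/- Let $Q$ be a smooth finite-dimensional manifold with tangent bundle $\pi:TQ\to Q$ and induced local coordinates $(q^a,v^a)$ on $TQ$. Let $S=\mathrm dq^a\otimes\partial/\partial v^a$ be the vertical endomorphism and $\Delta=v^a\,\partial/\partial v^a$ the dilation field of $TQ$. A smooth vector field $V$ on $TQ$ is vertical if $S(V)=0$, and a smooth vector field $D$ on $TQ$ is second order if $S(D)=\Delta$. A vector field $X^{(N)}$ on $TQ$ is Newtonian if it is the tangent lift $X^{(N)}=X^a\,\partial/\partial q^a+v^b(\partial X^a/\partial q^b)\,\partial/\partial v^a$ of a smooth vector field $X=X^a\,\partial/\partial q^a$ on $Q$. For a smooth function $\mathcal L:TQ\to\mathbb R$ put $\theta_{\mathcal L}=\mathrm d\mathcal L\circ S=(\partial\mathcal L/\partial v^a)\,\mathrm dq^a$ and $\omega_{\mathcal L}=-\mathrm d\theta_{\mathcal L}$. The Lagrangian $\mathcal L$ is regular if $\omega_{\mathcal L}$ is nondegenerate, and admissible for a second order field $D$ if $L_D\theta_{\mathcal L}=\mathrm d\mathcal L$. Let $D_0$ be a second order vector field on $TQ$, let $\mathcal L$ be a regular Lagrangian admissible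 for $D_0$, and let $X^{(N)}$ be a Newtonian vector field on $TQ$. (1) If $X^{(N)}$ is $\omega_{\mathcal L}$-Hamiltonian, i.e. $i_{X^{(N)}}\omega_{\mathcal L}=\mathrm d\varphi$ for a smooth function $\varphi$ on $TQ$, then the function $u=i_{X^{(N)}}\theta_{\mathcal L}-\varphi$ is smooth and satisfies, for every vertical vector field $V$ and every second order vector field $D$ on $TQ$ (in particular for $D=D_0$), $$L_Vu=0,\qquad L_V\bigl(L_{X^{(N)}}\mathcal L-L_Du\bigr)=0.\qquad(*)$$ (2) Conversely, if a smooth function $u$ on $TQ$ satisfies $(*)$ for every vertical vector field $V$ and every second order vector field $D$ on $TQ$, then $X^{(N)}$ is $\omega_{\mathcal L}$-Hamiltonian with smooth Hamiltonian function $\varphi=i_{X^{(N)}}\theta_{\mathcal L}-u$, i.e. $i_{X^{(N)}}\omega_{\mathcal L}=\mathrm d\bigl(i_{X^{(N)}}\theta_{\mathcal L}-u\bigr)$. -/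

import Mathlib

open scoped Manifold ContDiff

noncomputable section

namespace LagrangeNoether

/-! ### Functions, vector fields and differential forms on a manifold

A point of `TangentSpace I x` is a vector of the model space `E`: its components with respect to
the coordinates of the preferred chart at `x`. -/

section Calculus

variable {E : Type*} [NormedAddCommGroup E] [NormedSpace ℝ E] {H : Type*} [TopologicalSpace H]
  (I : ModelWithCorners ℝ E H) {M : Type*} [TopologicalSpace M] [ChartedSpace H M]

/-- `f` is a smooth real-valued function on `M`. -/
def IsSmoothFunction (f : M → ℝ) : Prop :=
  ContMDiff I 𝓘(ℝ, ℝ) ∞ f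

/-- `X` is a smooth vector field on `M`. -/
def IsSmoothVectorField [IsManifold I 1 M] (X : (x : M) → TangentSpace I x) : Prop :=
  ContMDiff I I.tangent ∞ (fun x : M => (⟨x, X x⟩ : TangentBundle I M))

/-- The Lie derivative `L_X f = df(X)` of a function. -/
def lieDerivFun (X : (x : M) → TangentSpace I x) (f : M → ℝ) (x : M) : ℝ :=
  mvfderiv I f x (X x)

/-- The contraction `i_X θ` of a 1-form. -/
def contractOne (X : (x : M) → TangentSpace I x) (θ : (x : M) → TangentSpace I x →L[ℝ] ℝ)
    (x : M) : ℝ :=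
  θ x (X x)

/-- The exterior derivative of a 1-form `θ`, evaluated on a pair of tangent vectors: the exterior
derivative of the expression of `θ` in the preferred chart at `x`, pulled back by that chart.
It is normalized by `dθ(X, Y) = X (θ(Y)) - Y (θ(X)) - θ([X, Y])`. -/
def extDerivOne (θ : (x : M) → TangentSpace I x →L[ℝ] ℝ) (x : M) (ξ η : TangentSpace I x) : ℝ :=
  extDerivWithin
    (fun y : E => ContinuousAlternatingMap.ofSubsingleton ℝ E ℝ (0 : Fin 1)
      ((θ ((extChartAt I x).symm y)).comp
        (mfderivWithin 𝓘(ℝ, E) I (extChartAt I x).symm (Set.range I) y)))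
    (Set.range I) (extChartAt I x x)
    ![mfderiv I 𝓘(ℝ, E) (extChartAt I x) x ξ, mfderiv I 𝓘(ℝ, E) (extChartAt I x) x η]

/-- The Lie derivative of a 1-form, `L_X θ = i_X dθ + d (i_X θ)`. -/
def lieDerivOne (X : (x : M) → TangentSpace I x) (θ : (x : M) → TangentSpace I x →L[ℝ] ℝ)
    (x : M) (η : TangentSpace I x) : ℝ :=
  extDerivOne I θ x (X x) η + mvfderiv I (contractOne I X θ) x η

/-- The vector field `X` is Hamiltonian for the 2-form `Ω` with (smooth) Hamiltonian function `φ`: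
`i_X Ω = dφ`. -/
def IsHamiltonianFor (Ω : (x : M) → TangentSpace I x → TangentSpace I x → ℝ)
    (X : (x : M) → TangentSpace I x) (φ : M → ℝ) : Prop :=
  IsSmoothFunction I φ ∧ ∀ (x : M) (η : TangentSpace I x), Ω x (X x) η = mvfderiv I φ x η

/-- The 2-form `Ω` is nondegenerate. -/
def Nondegenerate (Ω : (x : M) → TangentSpace I x → TangentSpace I x → ℝ) : Prop :=
  ∀ (x : M) (ξ : TangentSpace I x), (∀ η : TangentSpace I x, Ω x ξ η = 0) → ξ = 0

end Calculus

/-! ### The geometry of the tangent bundle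

`Q` is a manifold modelled on the vector space `E`. The preferred chart of `TQ` at a point `p` has
the coordinates `(q, v)` induced by the preferred chart of `Q` at the base point of `p`, so that
`TangentSpace 𝓘(ℝ, E).tangent p` is `E × E`, where `(a, b)` stands for
`a^i ∂/∂q^i + b^i ∂/∂v^i`. -/

section TangentBundle

variable (E : Type*) [NormedAddCommGroup E] [NormedSpace ℝ E]
  (Q : Type*) [TopologicalSpace Q] [ChartedSpace E Q] [IsManifold 𝓘(ℝ, E) ∞ Q]

/-- The tangent bundle `TQ`. -/
abbrev TQ : Type _ := TangentBundle 𝓘(ℝ, E) Q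

/-- The tangent space of `TQ` at the point `p`. -/
abbrev TTQ (p : TQ E Q) : Type _ := TangentSpace 𝓘(ℝ, E).tangent p

variable {E Q}

/-- The vertical endomorphism `S = dq^i ⊗ ∂/∂v^i`. -/
def verticalEndo (p : TQ E Q) : TTQ E Q p →L[ℝ] TTQ E Q p :=
  (ContinuousLinearMap.inr ℝ E E).comp (ContinuousLinearMap.fst ℝ E E)

/-- The dilation (Liouville) vector field `Δ = v^i ∂/∂v^i`. -/
def dilation (p : TQ E Q) : TTQ E Q p :=
  ContinuousLinearMap.inr ℝ E E p.2

/-- A smooth vector field `V` on `TQ` is vertical if `S(V) = 0`. -/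
def IsVertical (V : (p : TQ E Q) → TTQ E Q p) : Prop :=
  IsSmoothVectorField 𝓘(ℝ, E).tangent V ∧ ∀ p, verticalEndo p (V p) = 0

/-- A smooth vector field `D` on `TQ` is a second order vector field if `S(D) = Δ`. -/
def IsSecondOrder (D : (p : TQ E Q) → TTQ E Q p) : Prop :=
  IsSmoothVectorField 𝓘(ℝ, E).tangent D ∧ ∀ p, verticalEndo p (D p) = dilation p

/-- The tangent lift `X^(N) = X^i ∂/∂q^i + v^j (∂X^i/∂q^j) ∂/∂v^i` of a vector field `X` on `Q`.
At the point `v ∈ T_q Q` the derivative of the section `X : Q → TQ` along `v` has the components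
`(v^i, v^j ∂X^i/∂q^j)`. -/
def tangentLift (X : (q : Q) → TangentSpace 𝓘(ℝ, E) q) (p : TQ E Q) : TTQ E Q p :=
  let dX : E × E := mfderiv 𝓘(ℝ, E) 𝓘(ℝ, E).tangent (fun q : Q => (⟨q, X q⟩ : TQ E Q)) p.1 p.2
  let X₀ : E := X p.1
  ((X₀, dX.2) : E × E)

/-- A vector field on `TQ` is Newtonian if it is the tangent lift of a smooth vector field on `Q`,
that is the generator of the (local) flow `Tφ_s` on `TQ`, where `φ_s` is a (local) flow on `Q`. -/
def IsNewtonian (Y : (p : TQ E Q) → TTQ E Q p) : Prop :=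
  ∃ X : (q : Q) → TangentSpace 𝓘(ℝ, E) q,
    IsSmoothVectorField 𝓘(ℝ, E) X ∧ ∀ p, Y p = tangentLift X p

/-! ### Lagrangian functions -/

/-- The Cartan 1-form `θ_L = S(dL) = dL ∘ S`, that is `(∂L/∂v^i) dq^i`. -/
def cartanOne (L : TQ E Q → ℝ) (p : TQ E Q) : TTQ E Q p →L[ℝ] ℝ :=
  (mvfderiv 𝓘(ℝ, E).tangent L p).comp (verticalEndo p)

/-- The Lagrangian 2-form `ω_L = -dθ_L`. -/
def cartanTwo (L : TQ E Q → ℝ) (p : TQ E Q) (ξ η : TTQ E Q p) : ℝ :=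
  -extDerivOne 𝓘(ℝ, E).tangent (cartanOne L) p ξ η

/-- The smooth Lagrangian `L` is regular if the (exact, hence closed) 2-form `ω_L` is symplectic,
i.e. nondegenerate. -/
def IsRegularLagrangian (L : TQ E Q → ℝ) : Prop :=
  IsSmoothFunction 𝓘(ℝ, E).tangent L ∧ Nondegenerate 𝓘(ℝ, E).tangent (cartanTwo L)

/-- `L` is an admissible Lagrangian for the second order vector field `D`: `L_D θ_L = dL`. -/
def IsAdmissible (L : TQ E Q → ℝ) (D : (p : TQ E Q) → TTQ E Q p) : Prop :=
  ∀ (p : TQ E Q) (η : TTQ E Q p),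
    lieDerivOne 𝓘(ℝ, E).tangent D (cartanOne L) p η = mvfderiv 𝓘(ℝ, E).tangent L p η

/-- The conditions `L_V u = 0` and `L_V (L_Y L - L_D u) = 0`. -/
def NoetherConditions (L : TQ E Q → ℝ) (Y : (p : TQ E Q) → TTQ E Q p) (u : TQ E Q → ℝ)
    (V D : (p : TQ E Q) → TTQ E Q p) : Prop :=
  (∀ p, lieDerivFun 𝓘(ℝ, E).tangent V u p = 0) ∧
  ∀ p, lieDerivFun 𝓘(ℝ, E).tangent V
    (fun r => lieDerivFun 𝓘(ℝ, E).tangent Y L r - lieDerivFun 𝓘(ℝ, E).tangent D u r) p = 0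

end TangentBundle

end LagrangeNoether

end

/-!
In natural coordinates `(q, v)` the tangent lift of `X` is `Y = (X, X' v)` and `θ_L = (∂L/∂v) dq`.
Since `dq(Y) = X` does not depend on `v`, the Lie derivative `L_Y θ_L = i_Y dθ_L + d(i_Y θ_L)` is
horizontal: its value on `(a, b)` is
`A(a) = D²L(Y, (0, a)) + DL(0, X' a)`, the quantity `lieCoeff`.
As `ω_L = -dθ_L`, the equation `i_Y ω_L = dφ` with `φ = i_Y θ_L - u` says exactly that
`du = L_Y θ_L`, that is `du(a, b) = A(a)` (`mvfderiv_eq_lieCoeff_iff`).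

The Noether conditions express the same equation. The first one, `L_V u = 0` for vertical `V`, is
the equation on vertical vectors, and says that `u` depends on `q` only. Granted this,
`L_D u = Du(v, 0)` for every second order `D`, so that the vertical derivative of `L_Y L - L_D u`
along `(0, w)` is `A(w) - du(w, 0)` (`mvfderiv_noether`); its vanishing is the equation on the
remaining vectors. The symmetry of `D²L` is what identifies the two occurrences of `A`.

To go back from vector fields to vectors one needs a smooth vertical field through each vertical
vector (`exists_isVertical`) and one second order field.

The coordinate expressions are valid in the preferred chart at any point `p` because the
differential of a change of natural coordinates is `(a, b) ↦ (τ' a, τ''(a, v) + τ' b)`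
(`dChart_apply`), which respects vertical vectors, the vertical endomorphism, second order vectors
and, by the symmetry of `τ''`, tangent lifts (`dChart_tangentLift`).
-/

noncomputable section

namespace LagrangeNoether

open Set Filter Topology Bundle

variable {E : Type*} [NormedAddCommGroup E] [NormedSpace ℝ E]

/-! ### Calculus in the coordinates `(q, v)` -/

/-- The second derivative `D²f(ξ, η)` at `y`. -/
def hess (f : E × E → ℝ) (y ξ η : E × E) : ℝ := fderiv ℝ (fderiv ℝ f) y ξ η

theorem hess_comm {f : E × E → ℝ} {y : E × E} (hf : ContDiffAt ℝ ∞ f y) (ξ η : E × E) :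
    hess f y ξ η = hess f y η ξ :=
  hf.isSymmSndFDerivAt (by simpa using ENat.LEInfty.out) ξ η

theorem hasFDerivAt_fderiv_apply {f : E × E → ℝ} {y : E × E} (hf : ContDiffAt ℝ ∞ f y)
    {Z : E × E → E × E} {Z' : E × E →L[ℝ] E × E} (hZ : HasFDerivAt Z Z' y) :
    HasFDerivAt (fun z => fderiv ℝ f z (Z z))
      ((fderiv ℝ f y).comp Z' + (fderiv ℝ (fderiv ℝ f) y).flip (Z y)) y :=
  ((hf.fderiv_right (m := ∞) (by simp)).differentiableAt (by simp)).hasFDerivAt.clm_apply hZ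

theorem fderiv_fderiv_apply {f : E × E → ℝ} {y : E × E} (hf : ContDiffAt ℝ ∞ f y)
    {Z : E × E → E × E} {Z' : E × E →L[ℝ] E × E} (hZ : HasFDerivAt Z Z' y) (ξ : E × E) :
    fderiv ℝ (fun z => fderiv ℝ f z (Z z)) y ξ = fderiv ℝ f y (Z' ξ) + hess f y ξ (Z y) := by
  rw [(hasFDerivAt_fderiv_apply hf hZ).fderiv]; rfl

/-- The tangent lift `(X, X' v)` of a vector field `X` on `E`, at the point `y = (q, v)`. -/
def liftField (X : E → E) (y : E × E) : E × E := (X y.1, fderiv ℝ X y.1 y.2)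

/-- The value `D²f(Y, (0, a)) + Df(0, X' a)` on `(a, b)` of the Lie derivative of the Cartan form
`(∂f/∂v) dq` along the tangent lift `Y` of `X`; it does not depend on `b`. -/
def lieCoeff (f : E × E → ℝ) (X : E → E) (y : E × E) (a : E) : ℝ :=
  hess f y (liftField X y) (0, a) + fderiv ℝ f y (0, fderiv ℝ X y.1 a)

theorem lieCoeff_zero (f : E × E → ℝ) (X : E → E) (y : E × E) : lieCoeff f X y 0 = 0 := by
  rw [lieCoeff, hess, map_zero, Prod.mk_zero_zero, map_zero, map_zero, add_zero]

theorem fderiv_contract {f : E × E → ℝ} {X : E → E} {y : E × E} (hf : ContDiffAt ℝ ∞ f y)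
    (hX : ContDiffAt ℝ ∞ X y.1) (ξ : E × E) :
    fderiv ℝ (fun z => fderiv ℝ f z (0, X z.1)) y ξ =
      fderiv ℝ f y (0, fderiv ℝ X y.1 ξ.1) + hess f y ξ (0, X y.1) := by
  have hX1 := (hX.differentiableAt (by simp)).hasFDerivAt.comp y (hasFDerivAt_fst (𝕜 := ℝ) (p := y))
  exact fderiv_fderiv_apply hf ((hasFDerivAt_const (0 : E) y).prodMk hX1) ξ

theorem hasFDerivAt_liftField {X : E → E} {y : E × E} (hX : ContDiffAt ℝ ∞ X y.1) :
    HasFDerivAt (liftField X) (((fderiv ℝ X y.1).comp (.fst ℝ E E)).prod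
      ((fderiv ℝ X y.1).comp (.snd ℝ E E) +
          ((fderiv ℝ (fderiv ℝ X) y.1).comp (.fst ℝ E E)).flip y.2)) y := by
  have hX1 := (hX.differentiableAt (by simp)).hasFDerivAt.comp y (hasFDerivAt_fst (𝕜 := ℝ) (p := y))
  have hX2 := ((hX.fderiv_right (m := ∞) (by simp)).differentiableAt (by simp)).hasFDerivAt.comp y
    (hasFDerivAt_fst (𝕜 := ℝ) (p := y))
  exact hX1.prodMk (hX2.clm_apply (hasFDerivAt_snd (𝕜 := ℝ) (p := y)))

/-- The vertical derivative of `L_Y f - L_D u`, once `L_D u` has been replaced by `Du(v, 0)`. -/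
theorem fderiv_noether {f u g : E × E → ℝ} {X : E → E} {y : E × E} (hf : ContDiffAt ℝ ∞ f y)
    (hu : ContDiffAt ℝ ∞ u y) (hX : ContDiffAt ℝ ∞ X y.1)
    (hg : g =ᶠ[𝓝 y] fun z => fderiv ℝ f z (liftField X z) - fderiv ℝ u z (z.2, 0)) :
    DifferentiableAt ℝ g y ∧ ∀ w : E, fderiv ℝ g y (0, w) = lieCoeff f X y w
     - (fderiv ℝ u y (w, 0) + hess u y (0, w) (y.2, 0)) := by
  have h1 := hasFDerivAt_fderiv_apply hf (hasFDerivAt_liftField hX)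
  have h2 := hasFDerivAt_fderiv_apply hu ((hasFDerivAt_snd (𝕜 := ℝ) (p := y)).prodMk
    (hasFDerivAt_const (0 : E) y))
  have h3 := (h1.sub h2).congr_of_eventuallyEq hg
  refine ⟨h3.differentiableAt, fun w => ?_⟩
  rw [h3.fderiv, lieCoeff, hess_comm hf]
  simp [hess]
  ring

/-- If `u` does not depend on `v` near `y`, neither does its derivative. -/
theorem hess_eq_zero {u : E × E → ℝ} {y : E × E} (hu : ContDiffAt ℝ ∞ u y)
    (h : ∀ᶠ z in 𝓝 y, ∀ w, fderiv ℝ u z (0, w) = 0) (w : E) (η : E × E) :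
    hess u y (0, w) η = 0 := by
  have h1 : (fun z => fderiv ℝ u z (0, w)) =ᶠ[𝓝 y] fun _ => (0 : ℝ) := h.mono fun z hz => hz w
  have h2 := fderiv_fderiv_apply hu (hasFDerivAt_const ((0, w) : E × E) y) η
  rw [h1.fderiv_eq] at h2
  rw [hess_comm hu]
  simpa using h2.symm

/-- The exterior derivative of the Cartan form `(∂f/∂v) dq`. -/
theorem extDeriv_cartan {f : E × E → ℝ} {y : E × E} (hf : ContDiffAt ℝ ∞ f y)
    {θ : E × E → (E × E) →L[ℝ] ℝ} (hθ : θ =ᶠ[𝓝 y] fun z => (fderiv ℝ f z).comp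
      ((ContinuousLinearMap.inr ℝ E E).comp (ContinuousLinearMap.fst ℝ E E))) (ξ η : E × E) :
    extDeriv (fun z => ContinuousAlternatingMap.ofSubsingleton ℝ (E × E) ℝ (0 : Fin 1) (θ z)) y
      ![ξ, η] =
    hess f y ξ (0, η.1) - hess f y η (0, ξ.1) := by
  have h1 : (fun z => ContinuousAlternatingMap.ofSubsingleton ℝ (E × E) ℝ (0 : Fin 1) (θ z)) =ᶠ[𝓝 y]
    fun z => ContinuousAlternatingMap.ofSubsingleton ℝ (E × E) ℝ (0 : Fin 1) ((fderiv ℝ f z).comp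
      ((ContinuousLinearMap.inr ℝ E E).comp (ContinuousLinearMap.fst ℝ E E))) :=
    hθ.mono fun z hz => by simp only [hz]
  have hd : DifferentiableAt ℝ (fun z => (fderiv ℝ f z).comp
      ((ContinuousLinearMap.inr ℝ E E).comp (ContinuousLinearMap.fst ℝ E E))) y :=
    ((hf.fderiv_right (m := ∞) (by simp)).differentiableAt (by simp)).clm_comp
      (differentiableAt_const _)
  rw [h1.extDeriv_eq, extDeriv_apply]
  · rw [Fin.sum_univ_two]
    have key : ∀ a b : E × E,
        fderiv ℝ (fun z => fderiv ℝ f z (0, b.1)) y a = hess f y a (0, b.1) := by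
      intro a b
      simpa using fderiv_fderiv_apply hf (hasFDerivAt_const ((0, b.1) : E × E) y) a
    rw [← key, ← key]
    have hv1 : (Fin.removeNth (1 : Fin 2) ![ξ, η] : Fin 1 → E × E) 0 = ξ := rfl
    simp [hv1, sub_eq_add_neg]
  · exact (ContinuousAlternatingMap.ofSubsingletonLIE (𝕜 := ℝ) (E := E × E) (F := ℝ)
      (0 : Fin 1)).differentiable.differentiableAt.comp y hd

/-! ### Natural charts of the tangent bundle and their differentials -/

variable {Q : Type*} [TopologicalSpace Q] [ChartedSpace E Q]

/-- The change of coordinates from the preferred chart at `q` to the preferred chart at `q'`. -/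
def transition (q q' : Q) : E → E :=
  extChartAt 𝓘(ℝ, E) q' ∘ (extChartAt 𝓘(ℝ, E) q).symm

variable [IsManifold 𝓘(ℝ, E) ∞ Q]

theorem contDiffAt_transition {q q' z : Q} (hz : z ∈ (extChartAt 𝓘(ℝ, E) q).source)
    (hz' : z ∈ (extChartAt 𝓘(ℝ, E) q').source) :
    ContDiffAt ℝ ∞ (transition q q' : E → E) (extChartAt 𝓘(ℝ, E) q z) := by
  have hy : extChartAt 𝓘(ℝ, E) q z ∈
      ((extChartAt 𝓘(ℝ, E) q).symm ≫ extChartAt 𝓘(ℝ, E) q').source := by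
    rw [PartialEquiv.trans_source, PartialEquiv.symm_source]
    exact ⟨(extChartAt 𝓘(ℝ, E) q).map_source hz, by
      rwa [mem_preimage, (extChartAt 𝓘(ℝ, E) q).left_inv hz]⟩
  have h := contDiffWithinAt_ext_coord_change (n := ∞) (I := 𝓘(ℝ, E)) q' q hy
  rwa [modelWithCornersSelf_coe, range_id, contDiffWithinAt_univ] at h

theorem tangentCoordChange_eq_fderiv (q q' z : Q) :
    tangentCoordChange 𝓘(ℝ, E) q q' z = fderiv ℝ (transition q q') (extChartAt 𝓘(ℝ, E) q z) := by
  rw [tangentCoordChange_def, modelWithCornersSelf_coe, range_id, fderivWithin_univ]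
  rfl

theorem fderiv_transition_injective {q q' z : Q} (hz : z ∈ (extChartAt 𝓘(ℝ, E) q).source)
    (hz' : z ∈ (extChartAt 𝓘(ℝ, E) q').source) :
    Function.Injective (fderiv ℝ (transition q q') (extChartAt 𝓘(ℝ, E) q z)) := by
  rw [← tangentCoordChange_eq_fderiv]
  refine Function.LeftInverse.injective (g := tangentCoordChange 𝓘(ℝ, E) q' q z) fun v => ?_
  rw [tangentCoordChange_comp ⟨⟨hz, hz'⟩, hz⟩, tangentCoordChange_self hz]

/-- The components of a tangent vector of `Q` in the preferred chart at its own base point. -/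
def fiberCoord (r : TQ E Q) : E := r.2

/-- The components `(a, b)` of a tangent vector `ξ` of `TQ` at `r` in the natural coordinates of the
preferred chart at `r`. This is the identity, and serves only to change the type. -/
def components {r : TQ E Q} (ξ : TTQ E Q r) : E × E := ξ

/-- The natural coordinates `(q, v)` on `TQ` of the preferred chart at `p`. -/
abbrev natChart (p : TQ E Q) : PartialEquiv (TQ E Q) (E × E) := extChartAt 𝓘(ℝ, E).tangent p

/-- The differential at `r` of the natural coordinates at `p`, acting on `components ξ` for a
tangent vector `ξ` at `r`. -/
def dChart (p r : TQ E Q) : E × E →L[ℝ] E × E :=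
  mfderiv 𝓘(ℝ, E).tangent 𝓘(ℝ, E × E) (natChart p) r

theorem natChart_apply (p r : TQ E Q) :
    natChart p r =
      (extChartAt 𝓘(ℝ, E) p.1 r.1,
        fderiv ℝ (transition r.1 p.1) (extChartAt 𝓘(ℝ, E) r.1 r.1) (fiberCoord r)) := by
  rw [← tangentCoordChange_eq_fderiv]; rfl

theorem mem_natChart_source {p r : TQ E Q} :
    r ∈ (natChart p).source ↔ r.1 ∈ (extChartAt 𝓘(ℝ, E) p.1).source := by
  rw [extChartAt_source, extChartAt_source]
  exact TangentBundle.mem_chart_source_iff r p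

theorem natChart_target (p : TQ E Q) :
    (natChart p).target = (extChartAt 𝓘(ℝ, E) p.1).target ×ˢ univ := by
  have h : (extChartAt 𝓘(ℝ, E) p.1).target ⊆
      (extChartAt 𝓘(ℝ, E) p.1).symm ⁻¹' (extChartAt 𝓘(ℝ, E) p.1).source :=
    fun y hy => (extChartAt 𝓘(ℝ, E) p.1).map_target hy
  rw [natChart, ModelWithCorners.tangent, FiberBundle.extChartAt_target (IB := 𝓘(ℝ, E)) p,
    TangentBundle.trivializationAt_baseSet, ← extChartAt_source 𝓘(ℝ, E), inter_eq_left.2 h]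

theorem natChart_comp_symm (p r : TQ E Q) {y : E × E} (hy : y.1 ∈ (extChartAt 𝓘(ℝ, E) r.1).target)
    (hy' : (extChartAt 𝓘(ℝ, E) r.1).symm y.1 ∈ (extChartAt 𝓘(ℝ, E) p.1).source) :
    natChart p ((natChart r).symm y) =
      (transition r.1 p.1 y.1, fderiv ℝ (transition r.1 p.1) y.1 y.2) := by
  obtain ⟨s, hs, rfl⟩ : ∃ s ∈ (natChart r).source, natChart r s = y :=
    ⟨(natChart r).symm y, (natChart r).map_target (by rw [natChart_target]; exact ⟨hy, trivial⟩),
      (natChart r).right_inv (by rw [natChart_target]; exact ⟨hy, trivial⟩)⟩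
  rw [(natChart r).left_inv hs]
  rw [mem_natChart_source] at hs
  have h1 : (extChartAt 𝓘(ℝ, E) r.1).symm (natChart r s).1 = s.1 := by
    rw [natChart_apply]; exact (extChartAt 𝓘(ℝ, E) r.1).left_inv hs
  rw [h1] at hy'
  have h2 := tangentCoordChange_comp (I := 𝓘(ℝ, E)) (w := s.1) (x := r.1) (y := p.1) (z := s.1)
    (v := s.2)
    ⟨⟨mem_extChartAt_source _, hs⟩, hy'⟩
  simp only [tangentCoordChange_eq_fderiv] at h2
  rw [natChart_apply, natChart_apply, Prod.mk.injEq]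
  refine ⟨?_, h2.symm⟩
  rw [transition, Function.comp_apply, (extChartAt 𝓘(ℝ, E) r.1).left_inv hs]

theorem natChart_self (r : TQ E Q) : natChart r r = (extChartAt 𝓘(ℝ, E) r.1 r.1, fiberCoord r) := by
  rw [natChart_apply, ← tangentCoordChange_eq_fderiv,
    tangentCoordChange_self (mem_extChartAt_source r.1)]

theorem dChart_eq_fderiv {p r : TQ E Q} (hr : r.1 ∈ (extChartAt 𝓘(ℝ, E) p.1).source) :
    dChart p r =
      fderiv ℝ (natChart p ∘ (natChart r).symm) (extChartAt 𝓘(ℝ, E) r.1 r.1, fiberCoord r) := by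
  rw [← natChart_self, ← fderivWithin_univ]
  have : (univ : Set (E × E)) = range 𝓘(ℝ, E).tangent := by simp
  rw [this, dChart, ← tangentBundleCore_coordChange_achart,
    ← TangentBundle.continuousLinearMapAt_trivializationAt_eq_core,
    TangentBundle.continuousLinearMapAt_trivializationAt]
  · rw [extChartAt_source] at hr; simpa using hr
  · rw [extChartAt_source] at hr; simpa using hr

/-- The differential of `(q, v) ↦ (τ q, τ' v)`, with `τ` the change of coordinates of `Q`. -/
theorem dChart_apply {p r : TQ E Q} (hr : r.1 ∈ (extChartAt 𝓘(ℝ, E) p.1).source) (ξ : E × E) :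
    dChart p r ξ = (fderiv ℝ (transition r.1 p.1) (extChartAt 𝓘(ℝ, E) r.1 r.1) ξ.1,
      fderiv ℝ (fderiv ℝ (transition r.1 p.1)) (extChartAt 𝓘(ℝ, E) r.1 r.1) ξ.1 (fiberCoord r) +
      fderiv ℝ (transition r.1 p.1) (extChartAt 𝓘(ℝ, E) r.1 r.1) ξ.2) := by
  set x := extChartAt 𝓘(ℝ, E) r.1 r.1 with hx
  have hr' := mem_extChartAt_source (I := 𝓘(ℝ, E)) r.1
  have hτ : ContDiffAt ℝ ∞ (transition r.1 p.1) x := contDiffAt_transition hr' hr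
  rw [dChart_eq_fderiv hr]
  have hev : natChart p ∘ (natChart r).symm =ᶠ[𝓝 (x, fiberCoord r)]
      fun y => (transition r.1 p.1 y.1, fderiv ℝ (transition r.1 p.1) y.1 y.2) := by
    have h1 : ∀ᶠ q in 𝓝 x, q ∈ (extChartAt 𝓘(ℝ, E) r.1).target :=
      extChartAt_target_mem_nhds _
    have h2 : ∀ᶠ q in 𝓝 x, (extChartAt 𝓘(ℝ, E) r.1).symm q ∈ (extChartAt 𝓘(ℝ, E) p.1).source :=
      (continuousAt_extChartAt_symm r.1).eventually_mem (by
        rw [extChartAt_to_inv]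
        exact (isOpen_extChartAt_source p.1).mem_nhds hr)
    filter_upwards [continuousAt_fst.eventually (h1.and h2)] with y hy
    exact natChart_comp_symm p r hy.1 hy.2
  rw [hev.fderiv_eq]
  have hd1 : HasFDerivAt (transition r.1 p.1) (fderiv ℝ (transition r.1 p.1) x) x :=
    (hτ.differentiableAt (by simp)).hasFDerivAt
  have hd2 : HasFDerivAt (fderiv ℝ (transition r.1 p.1))
      (fderiv ℝ (fderiv ℝ (transition r.1 p.1)) x) x :=
    ((hτ.fderiv_right (m := ∞) (by simp)).differentiableAt (by simp)).hasFDerivAt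
  have hfst : HasFDerivAt (Prod.fst : E × E → E) (.fst ℝ E E) (x, fiberCoord r) :=
    hasFDerivAt_fst
  have hsnd : HasFDerivAt (Prod.snd : E × E → E) (.snd ℝ E E) (x, fiberCoord r) :=
    hasFDerivAt_snd
  have h := (hd1.comp (x, fiberCoord r) hfst).prodMk
    ((hd2.comp (x, fiberCoord r) hfst).clm_apply hsnd)
  refine (congrArg (fun A : E × E →L[ℝ] E × E => A ξ) h.fderiv).trans ?_
  simp [add_comm]

/-- The vertical endomorphism has the expression `(a, b) ↦ (0, a)` in every natural chart. -/
theorem dChart_zero_left {p r : TQ E Q} (hr : r.1 ∈ (extChartAt 𝓘(ℝ, E) p.1).source)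
    (ξ : E × E) : dChart p r (0, ξ.1) = (0, (dChart p r ξ).1) := by
  rw [dChart_apply hr, dChart_apply hr]
  simp

theorem components_fst_of_vertical {r : TQ E Q} {ξ : TTQ E Q r} (hξ : verticalEndo r ξ = 0) :
    (components ξ).1 = 0 :=
  congrArg Prod.snd (show ((0, (components ξ).1) : E × E) = 0 from hξ)

theorem components_fst_of_secondOrder {r : TQ E Q} {ξ : TTQ E Q r}
    (hξ : verticalEndo r ξ = dilation r) : (components ξ).1 = fiberCoord r :=
  congrArg Prod.snd (show ((0, (components ξ).1) : E × E) = (0, fiberCoord r) from hξ)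

theorem dChart_fst_of_secondOrder {p r : TQ E Q} (hr : r.1 ∈ (extChartAt 𝓘(ℝ, E) p.1).source)
    {ξ : TTQ E Q r} (hξ : verticalEndo r ξ = dilation r) :
    (dChart p r (components ξ)).1 = (natChart p r).2 := by
  rw [dChart_apply hr, natChart_apply, components_fst_of_secondOrder hξ]

/-! ### Tangent lifts in natural coordinates -/

/-- The components of a vector field on `Q` in the preferred chart at `p`. They are read off from
the natural chart of `TQ`, which is the same at all points over `p`; the zero vector is one of
them. -/
def fieldInChart (p : Q) (X : (q : Q) → TangentSpace 𝓘(ℝ, E) q) (y : E) : E :=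
  (natChart (⟨p, 0⟩ : TQ E Q) ⟨(extChartAt 𝓘(ℝ, E) p).symm y, X _⟩).2

theorem contDiffOn_fieldInChart (p : Q) {X : (q : Q) → TangentSpace 𝓘(ℝ, E) q}
    (hX : IsSmoothVectorField 𝓘(ℝ, E) X) :
    ContDiffOn ℝ ∞ (fieldInChart p X) (extChartAt 𝓘(ℝ, E) p).target := by
  rw [← contMDiffOn_iff_contDiffOn]
  have h1 : ContMDiffOn 𝓘(ℝ, E) 𝓘(ℝ, E).tangent ∞
      (fun y : E => (⟨(extChartAt 𝓘(ℝ, E) p).symm y, X _⟩ : TQ E Q))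
      (extChartAt 𝓘(ℝ, E) p).target :=
    hX.comp_contMDiffOn (contMDiffOn_extChartAt_symm p)
  have hmaps : MapsTo (fun y : E => (⟨(extChartAt 𝓘(ℝ, E) p).symm y, X _⟩ : TQ E Q))
      (extChartAt 𝓘(ℝ, E) p).target (chartAt (ModelProd E E) (⟨p, 0⟩ : TQ E Q)).source := by
    intro y hy
    rw [← extChartAt_source 𝓘(ℝ, E).tangent, mem_natChart_source]
    exact (extChartAt 𝓘(ℝ, E) p).map_target hy
  have h2 := (contMDiffOn_extChartAt (I := 𝓘(ℝ, E).tangent) (n := ∞)).comp h1 hmaps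
  exact contDiff_snd.contMDiff.comp_contMDiffOn h2

/-- In every natural chart the tangent lift of `X` is the tangent lift of the components of `X`. -/
theorem dChart_tangentLift {p r : TQ E Q} (hr : r.1 ∈ (extChartAt 𝓘(ℝ, E) p.1).source)
    {X : (q : Q) → TangentSpace 𝓘(ℝ, E) q} (hX : IsSmoothVectorField 𝓘(ℝ, E) X) :
    dChart p r (components (tangentLift X r)) = liftField (fieldInChart p.1 X) (natChart p r) := by
  set x := extChartAt 𝓘(ℝ, E) r.1 r.1 with hx
  set y := extChartAt 𝓘(ℝ, E) p.1 r.1 with hy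
  set σ : Q → TQ E Q := fun q => ⟨q, X q⟩ with hσ
  have hφs := (extChartAt 𝓘(ℝ, E) p.1).map_source hr
  have hr' := mem_extChartAt_source (I := 𝓘(ℝ, E)) r.1
  have hτ : ContDiffAt ℝ ∞ (transition r.1 p.1) x := contDiffAt_transition hr' hr
  -- `ζ` is the derivative of the section `σ` along `r`, a tangent vector of `TQ` at `σ r.1`.
  obtain ⟨ζ, hζ⟩ : ∃ ζ : E × E, ζ = (mfderiv 𝓘(ℝ, E) 𝓘(ℝ, E).tangent σ r.1 r.2 : E × E) := ⟨_, rfl⟩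
  have hlift : components (tangentLift X r) = (fiberCoord (σ r.1), ζ.2) := by rw [hζ]; rfl
  have hsec : natChart p ∘ σ =ᶠ[𝓝 r.1]
      (fun q => (q, fieldInChart p.1 X q)) ∘ extChartAt 𝓘(ℝ, E) p.1 := by
    filter_upwards [extChartAt_source_mem_nhds' hr] with q hq
    have : (extChartAt 𝓘(ℝ, E) p.1).symm (extChartAt 𝓘(ℝ, E) p.1 q) = q :=
      (extChartAt 𝓘(ℝ, E) p.1).left_inv hq
    refine Prod.ext rfl ?_
    exact congrArg (fun z => (natChart p (σ z)).2) this.symm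
  have hXd : DifferentiableAt ℝ (fieldInChart p.1 X) y :=
    ((contDiffOn_fieldInChart p.1 hX).contDiffAt
      ((isOpen_extChartAt_target p.1).mem_nhds hφs)).differentiableAt (by simp)
  have hφd : MDifferentiableAt 𝓘(ℝ, E) 𝓘(ℝ, E) (extChartAt 𝓘(ℝ, E) p.1) r.1 :=
    mdifferentiableAt_extChartAt (by rwa [← extChartAt_source 𝓘(ℝ, E)])
  have hφ' : (mfderiv 𝓘(ℝ, E) 𝓘(ℝ, E) (extChartAt 𝓘(ℝ, E) p.1) r.1 r.2 : E) =
      fderiv ℝ (transition r.1 p.1) x (fiberCoord r) := by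
    have hr₀ : r.1 ∈ (chartAt E p.1).source := by rwa [← extChartAt_source 𝓘(ℝ, E)]
    rw [← TangentBundle.continuousLinearMapAt_trivializationAt hr₀,
      TangentBundle.continuousLinearMapAt_trivializationAt_eq_core hr₀, hx,
      ← tangentCoordChange_eq_fderiv]
    rfl
  -- Differentiate the coordinate expression `q ↦ (q, X q)` of the section.
  have key : dChart p (σ r.1) ζ = (fderiv ℝ (transition r.1 p.1) x (fiberCoord r),
      fderiv ℝ (fieldInChart p.1 X) y (fderiv ℝ (transition r.1 p.1) x (fiberCoord r))) := by
    have h1 : mfderiv 𝓘(ℝ, E) 𝓘(ℝ, E × E) (natChart p ∘ σ) r.1 r.2 = dChart p (σ r.1) ζ := by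
      rw [mfderiv_comp (I' := 𝓘(ℝ, E).tangent), hζ]
      · rfl
      · exact mdifferentiableAt_extChartAt
          (by rwa [← extChartAt_source 𝓘(ℝ, E).tangent, mem_natChart_source])
      · exact (hX r.1).mdifferentiableAt (by simp)
    rw [← h1, hsec.mfderiv_eq, mfderiv_comp (I' := 𝓘(ℝ, E)) _ _ hφd, mfderiv_eq_fderiv]
    · have := (hasFDerivAt_id y).prodMk hXd.hasFDerivAt
      rw [← hφ']
      exact congrArg (fun A : E →L[ℝ] E × E => A _) this.fderiv
    · exact ((differentiableAt_id).prodMk hXd).mdifferentiableAt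
  rw [dChart_apply (r := σ r.1) hr] at key
  have k2 := congrArg Prod.snd key
  have k1 := congrArg Prod.fst key
  have hζ1 : ζ.1 = fiberCoord r :=
    fderiv_transition_injective hr' hr k1
  -- `τ''` enters with arguments `(v, X)` at the point `σ r.1`, and `(X, v)` at the point `r`.
  have hsymm := hτ.isSymmSndFDerivAt (by simpa using ENat.LEInfty.out)
  rw [hlift, dChart_apply hr, natChart_apply, liftField]
  refine Prod.ext ?_ ?_
  · have := congrArg Prod.snd hsec.self_of_nhds
    simp only [Function.comp_apply] at this
    rw [natChart_apply] at this
    exact this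
  · refine Eq.trans ?_ k2
    rw [hζ1]
    exact congrArg (· + _) (hsymm _ _)

/-! ### Functions and Cartan forms in natural coordinates -/

/-- The expression of a function on `TQ` in the natural chart at `p`. -/
def chartExpr (p : TQ E Q) (f : TQ E Q → ℝ) (y : E × E) : ℝ := f ((natChart p).symm y)

theorem natChart_target_mem_nhds {p r : TQ E Q} (hr : r.1 ∈ (extChartAt 𝓘(ℝ, E) p.1).source) :
    (natChart p).target ∈ 𝓝 (natChart p r) :=
  extChartAt_target_mem_nhds' ((natChart p).map_source (mem_natChart_source.2 hr))

theorem contDiffOn_chartExpr (p : TQ E Q) {f : TQ E Q → ℝ}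
    (hf : IsSmoothFunction 𝓘(ℝ, E).tangent f) :
    ContDiffOn ℝ ∞ (chartExpr p f) (natChart p).target := by
  rw [← contMDiffOn_iff_contDiffOn]
  exact ContMDiff.comp_contMDiffOn hf (contMDiffOn_extChartAt_symm p)

theorem contDiffAt_chartExpr {p r : TQ E Q} (hr : r.1 ∈ (extChartAt 𝓘(ℝ, E) p.1).source)
    {f : TQ E Q → ℝ} (hf : IsSmoothFunction 𝓘(ℝ, E).tangent f) :
    ContDiffAt ℝ ∞ (chartExpr p f) (natChart p r) :=
  (contDiffOn_chartExpr p hf).contDiffAt (natChart_target_mem_nhds hr)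

theorem eventuallyEq_chartExpr_comp {p r : TQ E Q} (hr : r.1 ∈ (extChartAt 𝓘(ℝ, E) p.1).source)
    (f : TQ E Q → ℝ) : f =ᶠ[𝓝 r] chartExpr p f ∘ natChart p := by
  filter_upwards [extChartAt_source_mem_nhds' (mem_natChart_source.2 hr)] with s hs
  exact congrArg f ((natChart p).left_inv hs).symm

theorem mvfderiv_eq_fderiv_chartExpr {p r : TQ E Q} (hr : r.1 ∈ (extChartAt 𝓘(ℝ, E) p.1).source)
    {f : TQ E Q → ℝ} (hf : DifferentiableAt ℝ (chartExpr p f) (natChart p r)) (ξ : TTQ E Q r) :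
    mvfderiv 𝓘(ℝ, E).tangent f r ξ =
      fderiv ℝ (chartExpr p f) (natChart p r) (dChart p r (components ξ)) := by
  have hr' : r ∈ (chartAt (ModelProd E E) p).source := by
    rw [← extChartAt_source 𝓘(ℝ, E).tangent]; exact mem_natChart_source.2 hr
  have h : mfderiv 𝓘(ℝ, E).tangent 𝓘(ℝ, ℝ) f r =
      (mfderiv 𝓘(ℝ, E × E) 𝓘(ℝ, ℝ) (chartExpr p f) (natChart p r)).comp
        (mfderiv 𝓘(ℝ, E).tangent 𝓘(ℝ, E × E) (natChart p) r) := by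
    rw [(eventuallyEq_chartExpr_comp hr f).mfderiv_eq]
    exact mfderiv_comp r hf.mdifferentiableAt (mdifferentiableAt_extChartAt hr')
  rw [mfderiv_eq_fderiv] at h
  exact congrArg (fun A : E × E →L[ℝ] ℝ => A ξ) h

/-- `θ = (∂f/∂v) dq` in every natural chart. -/
theorem cartanOne_eq {p r : TQ E Q} (hr : r.1 ∈ (extChartAt 𝓘(ℝ, E) p.1).source)
    {f : TQ E Q → ℝ} (hf : IsSmoothFunction 𝓘(ℝ, E).tangent f) (ξ : TTQ E Q r) :
    cartanOne f r ξ =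
      fderiv ℝ (chartExpr p f) (natChart p r) (0, (dChart p r (components ξ)).1) := by
  rw [← dChart_zero_left hr]
  exact mvfderiv_eq_fderiv_chartExpr hr ((contDiffAt_chartExpr hr hf).differentiableAt (by simp)) _

theorem dChart_self (p : TQ E Q) (ξ : E × E) : dChart p p ξ = ξ := by
  rw [dChart, natChart, mfderiv_extChartAt_self]; rfl

/-- `ω = -d((∂f/∂v) dq)` at `p`, in the natural chart at `p` itself, whose differential at `p` is the
identity. -/
theorem cartanTwo_eq (p : TQ E Q) {f : TQ E Q → ℝ} (hf : IsSmoothFunction 𝓘(ℝ, E).tangent f)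
    (ξ η : TTQ E Q p) :
    cartanTwo f p ξ η = hess (chartExpr p f) (natChart p p) (components η) (0, (components ξ).1) -
      hess (chartExpr p f) (natChart p p) (components ξ) (0, (components η).1) := by
  have hp := mem_extChartAt_source (I := 𝓘(ℝ, E)) p.1
  have hθ : (fun y : E × E => ((cartanOne f ((natChart p).symm y)).comp
        (mfderivWithin 𝓘(ℝ, E × E) 𝓘(ℝ, E).tangent (natChart p).symm
          (range 𝓘(ℝ, E).tangent) y) : E × E →L[ℝ] ℝ)) =ᶠ[𝓝 (natChart p p)]
      fun z => (fderiv ℝ (chartExpr p f) z).comp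
        ((ContinuousLinearMap.inr ℝ E E).comp (ContinuousLinearMap.fst ℝ E E)) := by
    filter_upwards [natChart_target_mem_nhds hp] with y hy
    have hs := (natChart p).map_target hy
    refine ContinuousLinearMap.ext fun ζ => ?_
    have h1 := cartanOne_eq (mem_natChart_source.1 hs) hf
      (mfderivWithin 𝓘(ℝ, E × E) 𝓘(ℝ, E).tangent (natChart p).symm
        (range 𝓘(ℝ, E).tangent) y ζ)
    rw [(natChart p).right_inv hy] at h1
    have h2 := congrArg (fun A : E × E →L[ℝ] E × E => A ζ)
      (mfderiv_extChartAt_comp_mfderivWithin_extChartAt_symm (I := 𝓘(ℝ, E).tangent) (x := p) hy)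
    refine h1.trans ?_
    exact congrArg (fun ζ : E × E => fderiv ℝ (chartExpr p f) y (0, ζ.1)) h2
  have h := extDeriv_cartan (contDiffAt_chartExpr hp hf) hθ (components ξ) (components η)
  rw [cartanTwo, extDerivOne, mfderiv_extChartAt_self]
  rw [← neg_sub, ← h, ← extDerivWithin_univ]
  have : (univ : Set (E × E)) = range 𝓘(ℝ, E).tangent := by simp
  rw [this]
  rfl

theorem isSmoothFunction_of_chartExpr {f : TQ E Q → ℝ}
    (hf : ∀ p, ContDiffOn ℝ ∞ (chartExpr p f) (natChart p).target) :
    IsSmoothFunction 𝓘(ℝ, E).tangent f := by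
  intro p
  have hp := mem_extChartAt_source (I := 𝓘(ℝ, E)) p.1
  refine ContMDiffAt.congr_of_eventuallyEq ?_ (eventuallyEq_chartExpr_comp hp f)
  exact ((hf p).contDiffAt (natChart_target_mem_nhds hp)).contMDiffAt.comp p contMDiffAt_extChartAt

/-! ### Vertical vectors and vertical vector fields -/

theorem verticalEndo_eq_zero {r : TQ E Q} {ξ : TTQ E Q r} (h : (components ξ).1 = 0) :
    verticalEndo r ξ = 0 :=
  show ((0, (components ξ).1) : E × E) = 0 by rw [h]; rfl

theorem exists_vertical_dChart_eq {p r : TQ E Q} (hr : r.1 ∈ (extChartAt 𝓘(ℝ, E) p.1).source)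
    (w : E) :
    ∃ ξ : TTQ E Q r, verticalEndo r ξ = 0 ∧ dChart p r (components ξ) = (0, w) := by
  have hr' := mem_extChartAt_source (I := 𝓘(ℝ, E)) r.1
  refine ⟨((0, tangentCoordChange 𝓘(ℝ, E) p.1 r.1 r.1 w) : E × E), verticalEndo_eq_zero rfl, ?_⟩
  have h : fderiv ℝ (transition r.1 p.1) (extChartAt 𝓘(ℝ, E) r.1 r.1)
      (tangentCoordChange 𝓘(ℝ, E) p.1 r.1 r.1 w) = w := by
    rw [← tangentCoordChange_eq_fderiv, tangentCoordChange_comp ⟨⟨hr, hr'⟩, hr⟩,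
      tangentCoordChange_self hr]
  rw [dChart_apply hr]
  refine Prod.ext (map_zero _) (Eq.trans ?_ h)
  simp [components]

theorem components_fst_of_dChart {p r : TQ E Q} (hr : r.1 ∈ (extChartAt 𝓘(ℝ, E) p.1).source)
    {ξ : TTQ E Q r} (h : (dChart p r (components ξ)).1 = 0) : (components ξ).1 = 0 := by
  rw [dChart_apply hr] at h
  exact fderiv_transition_injective (mem_extChartAt_source (I := 𝓘(ℝ, E)) r.1) hr
    (h.trans (map_zero _).symm)

/-- A vertical vector extends to a smooth vertical vector field: take constant components in the
natural chart and cut off by a bump function on `Q`, pulled back to `TQ`. -/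
theorem exists_isVertical [FiniteDimensional ℝ E] [T2Space Q] (p : TQ E Q) (ξ : TTQ E Q p)
    (hξ : verticalEndo p ξ = 0) : ∃ V : (r : TQ E Q) → TTQ E Q r, IsVertical V ∧ V p = ξ := by
  let e := trivializationAt (E × E) (TangentSpace 𝓘(ℝ, E).tangent : TQ E Q → Type _) p
  let f : SmoothBumpFunction 𝓘(ℝ, E) p.1 := Classical.arbitrary _
  let s : (r : TQ E Q) → TTQ E Q r := fun r => e.symm r (components ξ)
  let ψ : TQ E Q → ℝ := fun r => f r.1
  have hbase : ∀ r : TQ E Q, r ∈ e.baseSet ↔ r.1 ∈ (extChartAt 𝓘(ℝ, E) p.1).source := fun r => by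
    rw [← mem_natChart_source, extChartAt_source]; rfl
  have hs : ContMDiffOn 𝓘(ℝ, E).tangent 𝓘(ℝ, E).tangent.tangent ∞
      (fun r : TQ E Q => (⟨r, s r⟩ : TangentBundle 𝓘(ℝ, E).tangent (TQ E Q))) e.baseSet := by
    refine (e.contMDiffOn_section_baseSet_iff).2
      ((contMDiffOn_const (c := components ξ)).congr fun r hr => ?_)
    exact congrArg Prod.snd (e.apply_mk_symm hr (components ξ))
  have hsd : ∀ r : TQ E Q, r ∈ e.baseSet → dChart p r (components (s r)) = components ξ :=
      fun r hr => by
    rw [dChart, natChart, ← TangentBundle.continuousLinearMapAt_trivializationAt hr]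
    refine Eq.trans (congrArg _ ?_) (e.continuousLinearMapAt_symmL (R := ℝ) hr (components ξ))
    exact (e.symmL_apply (R := ℝ) hr (components ξ)).symm
  refine ⟨ψ • s, ⟨?_, fun r => ?_⟩, ?_⟩
  · refine ContMDiffOn.smul_section_of_tsupport (u := e.baseSet) ?_ e.open_baseSet ?_ hs
    · exact (f.contMDiff.comp (contMDiff_proj _)).contMDiffOn
    · intro r hr
      rw [hbase]
      exact f.tsupport_subset_extChartAt_source (tsupport_comp_subset_preimage f
        (FiberBundle.continuous_proj E _) hr)
  · have h1 : verticalEndo r ((ψ • s) r) = ψ r • verticalEndo r (s r) :=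
      (verticalEndo r).map_smul (ψ r) (s r)
    rw [h1]
    by_cases hr : r ∈ e.baseSet
    · rw [verticalEndo_eq_zero, smul_zero]
      refine components_fst_of_dChart ((hbase r).1 hr) ?_
      rw [hsd r hr]
      exact components_fst_of_vertical hξ
    · have : ψ r = 0 := by
        by_contra h
        rw [hbase] at hr
        exact hr (f.tsupport_subset_extChartAt_source (subset_tsupport _ h))
      rw [this, zero_smul]
  · have h1 : (ψ • s) p = ψ p • s p := rfl
    have h2 : ψ p = 1 := f.eq_one
    have h3 := hsd p ((hbase p).2 (mem_extChartAt_source p.1))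
    rw [dChart_self] at h3
    rw [h1, h2, one_smul]
    exact h3

/-! ### The Noether conditions at a point -/

variable {L : TQ E Q → ℝ} {X : (q : Q) → TangentSpace 𝓘(ℝ, E) q} {u : TQ E Q → ℝ}

theorem chartExpr_contractOne (hL : IsSmoothFunction 𝓘(ℝ, E).tangent L)
    (hX : IsSmoothVectorField 𝓘(ℝ, E) X) (p : TQ E Q) {y : E × E} (hy : y ∈ (natChart p).target) :
    chartExpr p (contractOne 𝓘(ℝ, E).tangent (tangentLift X) (cartanOne L)) y =
      fderiv ℝ (chartExpr p L) y (0, fieldInChart p.1 X y.1) := by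
  have hr := mem_natChart_source.1 ((natChart p).map_target hy)
  have h := cartanOne_eq hr hL (tangentLift X _)
  rw [dChart_tangentLift hr hX, (natChart p).right_inv hy] at h
  exact h

theorem contDiffAt_fieldInChart (hX : IsSmoothVectorField 𝓘(ℝ, E) X) (p : TQ E Q)
    {y : E × E} (hy : y ∈ (natChart p).target) :
    ContDiffAt ℝ ∞ (fieldInChart p.1 X) y.1 :=
  (contDiffOn_fieldInChart p.1 hX).contDiffAt ((isOpen_extChartAt_target p.1).mem_nhds
    (by rw [natChart_target] at hy; exact hy.1))

theorem isSmoothFunction_contractOne (hL : IsSmoothFunction 𝓘(ℝ, E).tangent L)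
    (hX : IsSmoothVectorField 𝓘(ℝ, E) X) :
    IsSmoothFunction 𝓘(ℝ, E).tangent
      (contractOne 𝓘(ℝ, E).tangent (tangentLift X) (cartanOne L)) := by
  refine isSmoothFunction_of_chartExpr fun p => ContDiffOn.congr ?_ fun y hy =>
    chartExpr_contractOne hL hX p hy
  intro y hy
  have h1 := (contDiffOn_chartExpr p hL).contDiffAt ((isOpen_extChartAt_target p).mem_nhds hy)
  exact ((h1.fderiv_right (m := ∞) (by simp)).clm_apply (contDiffAt_const.prodMk
    ((contDiffAt_fieldInChart hX p hy).comp y contDiffAt_fst))).contDiffWithinAt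

/-- The identity `i_Y ω - d(i_Y θ - u) = du - L_Y θ`. -/
theorem cartanTwo_sub_mvfderiv (hL : IsSmoothFunction 𝓘(ℝ, E).tangent L)
    (hX : IsSmoothVectorField 𝓘(ℝ, E) X) (hu : IsSmoothFunction 𝓘(ℝ, E).tangent u) (p : TQ E Q)
    (η : TTQ E Q p) :
    cartanTwo L p (tangentLift X p) η - mvfderiv 𝓘(ℝ, E).tangent
      (fun r => contractOne 𝓘(ℝ, E).tangent (tangentLift X) (cartanOne L) r - u r) p η =
    mvfderiv 𝓘(ℝ, E).tangent u p η -
      lieCoeff (chartExpr p L) (fieldInChart p.1 X) (natChart p p) (components η).1 := by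
  have hp := mem_extChartAt_source (I := 𝓘(ℝ, E)) p.1
  have hy := (natChart p).map_source (mem_natChart_source.2 hp)
  have hL' := contDiffAt_chartExpr hp hL
  have hu' := (contDiffAt_chartExpr hp hu).differentiableAt (by simp)
  have hc' :=
    (contDiffAt_chartExpr hp (isSmoothFunction_contractOne hL hX)).differentiableAt (by simp)
  have hcf : fderiv ℝ (chartExpr p (contractOne 𝓘(ℝ, E).tangent (tangentLift X) (cartanOne L)))
      (natChart p p) = fderiv ℝ (fun y => fderiv ℝ (chartExpr p L) y (0, fieldInChart p.1 X y.1))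
        (natChart p p) :=
    Filter.EventuallyEq.fderiv_eq (by
      filter_upwards [natChart_target_mem_nhds hp] with y hy using chartExpr_contractOne hL hX p hy)
  have hY : components (tangentLift X p) = liftField (fieldInChart p.1 X) (natChart p p) := by
    rw [← dChart_self p (components _)]; exact dChart_tangentLift hp hX
  rw [mvfderiv_eq_fderiv_chartExpr
      (f := fun r => contractOne 𝓘(ℝ, E).tangent (tangentLift X) (cartanOne L) r - u r)
      hp (hc'.sub hu'), mvfderiv_eq_fderiv_chartExpr hp hu', dChart_self,
    cartanTwo_eq p hL, hY]
  have hsub := fderiv_sub hc' hu'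
  have h := congrArg (fun A : E × E →L[ℝ] ℝ => A (components η)) hsub
  refine (congrArg (_ - ·) h).trans ?_
  rw [sub_apply, hcf,
    fderiv_contract hL' (contDiffAt_fieldInChart hX p hy), lieCoeff]
  simp only [liftField]
  ring

/-- `du = L_Y θ` if and only if `i_Y ω = d(i_Y θ - u)`. -/
theorem mvfderiv_eq_lieCoeff_iff (hL : IsSmoothFunction 𝓘(ℝ, E).tangent L)
    (hX : IsSmoothVectorField 𝓘(ℝ, E) X) (hu : IsSmoothFunction 𝓘(ℝ, E).tangent u) (p : TQ E Q)
    (η : TTQ E Q p) :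
    mvfderiv 𝓘(ℝ, E).tangent u p η =
        lieCoeff (chartExpr p L) (fieldInChart p.1 X) (natChart p p) (components η).1 ↔
      cartanTwo L p (tangentLift X p) η = mvfderiv 𝓘(ℝ, E).tangent
        (fun r => contractOne 𝓘(ℝ, E).tangent (tangentLift X) (cartanOne L) r - u r) p η := by
  rw [← sub_eq_zero, ← cartanTwo_sub_mvfderiv hL hX hu p η, sub_eq_zero]

/-- A function killed by vertical vectors does not depend on `v` in natural coordinates. -/
theorem fderiv_chartExpr_vertical (hu : IsSmoothFunction 𝓘(ℝ, E).tangent u)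
    (hv : ∀ (r : TQ E Q) (ξ : TTQ E Q r), verticalEndo r ξ = 0 → mvfderiv 𝓘(ℝ, E).tangent u r ξ = 0)
    (p : TQ E Q) {y : E × E} (hy : y ∈ (natChart p).target) (w : E) :
    fderiv ℝ (chartExpr p u) y (0, w) = 0 := by
  have hr := mem_natChart_source.1 ((natChart p).map_target hy)
  obtain ⟨ξ, hξ, hw⟩ := exists_vertical_dChart_eq hr w
  have h := mvfderiv_eq_fderiv_chartExpr hr
    ((contDiffAt_chartExpr hr hu).differentiableAt (by simp)) ξ
  rw [hv _ ξ hξ, hw, (natChart p).right_inv hy] at h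
  exact h.symm

/-- If `u` is constant along the fibres, the derivative of `L_Y L - L_D u` along the vertical vector
`(0, w)` is the value of `L_Y θ - du` on any vector `(w, b)`. -/
theorem mvfderiv_noether (hL : IsSmoothFunction 𝓘(ℝ, E).tangent L)
    (hX : IsSmoothVectorField 𝓘(ℝ, E) X) (hu : IsSmoothFunction 𝓘(ℝ, E).tangent u)
    (hv : ∀ (r : TQ E Q) (ξ : TTQ E Q r), verticalEndo r ξ = 0 → mvfderiv 𝓘(ℝ, E).tangent u r ξ = 0)
    {D : (r : TQ E Q) → TTQ E Q r} (hD : ∀ r, verticalEndo r (D r) = dilation r) (p : TQ E Q)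
    (ξ η : TTQ E Q p) (hξ : verticalEndo p ξ = 0) (hη : (components ξ).2 = (components η).1) :
    mvfderiv 𝓘(ℝ, E).tangent (fun r => lieDerivFun 𝓘(ℝ, E).tangent (tangentLift X) L r -
      lieDerivFun 𝓘(ℝ, E).tangent D u r) p ξ =
    lieCoeff (chartExpr p L) (fieldInChart p.1 X) (natChart p p) (components η).1 -
      mvfderiv 𝓘(ℝ, E).tangent u p η := by
  have hp := mem_extChartAt_source (I := 𝓘(ℝ, E)) p.1
  have hy := (natChart p).map_source (mem_natChart_source.2 hp)
  have hL' := contDiffAt_chartExpr hp hL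
  have hu' := contDiffAt_chartExpr hp hu
  have hvert : ∀ y ∈ (natChart p).target, ∀ w, fderiv ℝ (chartExpr p u) y (0, w) = 0 :=
    fun y hy w => fderiv_chartExpr_vertical hu hv p hy w
  -- Only the base component of `D`, which is prescribed, contributes to `L_D u`.
  have hsplit : ∀ y ∈ (natChart p).target, ∀ ζ : E × E,
      fderiv ℝ (chartExpr p u) y ζ = fderiv ℝ (chartExpr p u) y (ζ.1, 0) := fun y hy ζ => by
    have : ζ = (ζ.1, 0) + (0, ζ.2) := by simp
    conv_lhs => rw [this, map_add, hvert y hy, add_zero]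
  -- `hg` guarantees that the derivative of `L_Y L - L_D u` at `p` is not a junk zero.
  obtain ⟨hg, hgd⟩ := fderiv_noether hL' hu' (contDiffAt_fieldInChart hX p hy)
    (g := chartExpr p fun r => lieDerivFun 𝓘(ℝ, E).tangent (tangentLift X) L r -
      lieDerivFun 𝓘(ℝ, E).tangent D u r) (by
    filter_upwards [natChart_target_mem_nhds hp] with y hy
    have hr := mem_natChart_source.1 ((natChart p).map_target hy)
    have h1 := mvfderiv_eq_fderiv_chartExpr hr
      ((contDiffAt_chartExpr hr hL).differentiableAt (by simp)) (tangentLift X _)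
    have h2 := mvfderiv_eq_fderiv_chartExpr hr
      ((contDiffAt_chartExpr hr hu).differentiableAt (by simp)) (D _)
    rw [dChart_tangentLift hr hX, (natChart p).right_inv hy] at h1
    rw [(natChart p).right_inv hy, hsplit y hy, dChart_fst_of_secondOrder hr (hD _),
      (natChart p).right_inv hy] at h2
    exact congrArg₂ (· - ·) h1 h2)
  have hξ' : components ξ = (0, (components η).1) :=
    Prod.ext (components_fst_of_vertical hξ) hη
  rw [mvfderiv_eq_fderiv_chartExpr hp hg,
    mvfderiv_eq_fderiv_chartExpr hp (hu'.differentiableAt (by simp)), dChart_self, dChart_self,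
    hsplit _ hy, hξ', hgd, hess_eq_zero hu', add_zero]
  filter_upwards [natChart_target_mem_nhds hp] with y hy using hvert y hy

end LagrangeNoether

end

open LagrangeNoether in
theorem mainTheorem2
    {E : Type*} [NormedAddCommGroup E] [NormedSpace ℝ E] [FiniteDimensional ℝ E]
    {Q : Type*} [TopologicalSpace Q] [T2Space Q] [SecondCountableTopology Q]
    [ChartedSpace E Q] [IsManifold 𝓘(ℝ, E) ∞ Q]
    (L : TQ E Q → ℝ) (hL : IsRegularLagrangian L)
    (D : (p : TQ E Q) → TTQ E Q p) (hD : IsSecondOrder D) (hLD : IsAdmissible L D)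
    (Y : (p : TQ E Q) → TTQ E Q p) (hY : IsNewtonian Y) :
    (∀ φ u : TQ E Q → ℝ,
      IsHamiltonianFor 𝓘(ℝ, E).tangent (cartanTwo L) Y φ →
      (∀ p, u p = contractOne 𝓘(ℝ, E).tangent Y (cartanOne L) p - φ p) →
      IsSmoothFunction 𝓘(ℝ, E).tangent u ∧
      ∀ V D' : (p : TQ E Q) → TTQ E Q p, IsVertical V → IsSecondOrder D' →
        NoetherConditions L Y u V D') ∧
    (∀ u : TQ E Q → ℝ,
      IsSmoothFunction 𝓘(ℝ, E).tangent u →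
      (∀ V D' : (p : TQ E Q) → TTQ E Q p, IsVertical V → IsSecondOrder D' →
        NoetherConditions L Y u V D') →
      IsHamiltonianFor 𝓘(ℝ, E).tangent (cartanTwo L) Y
        (fun p => contractOne 𝓘(ℝ, E).tangent Y (cartanOne L) p - u p)) := by
  obtain ⟨X, hX, hYX⟩ := hY
  obtain rfl : Y = tangentLift X := funext hYX
  have hθ := isSmoothFunction_contractOne hL.1 hX
  refine ⟨fun φ u hφ hu => ?_, fun u hu h => ?_⟩
  · have hus : IsSmoothFunction 𝓘(ℝ, E).tangent u := by
      rw [show u = _ from funext hu]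
      exact ContMDiff.sub hθ hφ.1
    have hφu : φ = fun p =>
        contractOne 𝓘(ℝ, E).tangent (tangentLift X) (cartanOne L) p - u p :=
      funext fun p => by rw [hu p, sub_sub_cancel]
    have hdu := mvfderiv_eq_lieCoeff_iff hL.1 hX hus
    rw [hφu] at hφ
    have hv : ∀ (r : TQ E Q) (ξ : TTQ E Q r), verticalEndo r ξ = 0 →
        mvfderiv 𝓘(ℝ, E).tangent u r ξ = 0 := fun r ξ hξ => by
      rw [(hdu r ξ).2 (hφ.2 r ξ), components_fst_of_vertical hξ, lieCoeff_zero]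
    refine ⟨hus, fun V D' hV hD' => ⟨fun p => hv p _ (hV.2 p), fun p => ?_⟩⟩
    -- For `V p = (0, w)`, evaluate `L_Y θ = du` on `(w, 0)`.
    let η : TTQ E Q p := (((components (V p)).2, 0) : E × E)
    exact (mvfderiv_noether hL.1 hX hus hv hD'.2 p (V p) η (hV.2 p) rfl).trans
      (sub_eq_zero.2 ((hdu p η).2 (hφ.2 p η)).symm)
  · have hv : ∀ (r : TQ E Q) (ξ : TTQ E Q r), verticalEndo r ξ = 0 →
        mvfderiv 𝓘(ℝ, E).tangent u r ξ = 0 := fun r ξ hξ => by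
      obtain ⟨V, hV, rfl⟩ := exists_isVertical r ξ hξ
      exact (h V D hV hD).1 r
    refine ⟨ContMDiff.sub hθ hu, fun p η => (mvfderiv_eq_lieCoeff_iff hL.1 hX hu p η).1 ?_⟩
    -- For `η = (a, b)`, use a vertical field through `(0, a)`.
    let ξ : TTQ E Q p := ((0, (components η).1) : E × E)
    have hξ : verticalEndo p ξ = 0 := verticalEndo_eq_zero rfl
    obtain ⟨V, hV, hVξ⟩ := exists_isVertical p ξ hξ
    have h2 := (h V D hV hD).2 p
    rw [lieDerivFun, hVξ] at h2
    exact (sub_eq_zero.1 ((mvfderiv_noether hL.1 hX hu hv hD.2 p ξ η hξ rfl).symm.trans h2)).symm
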